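/- By a graph we mean a set of vertices with a symmetric binary relation, not necessarily irreflexive (so self-loops are allowed). For a structure $N$ with a binary relation $\in^N$, the D-graph (double-membership graph) $N_1$ of $N$ is the graph with vertex set $N$ in which $x,y$ are adjacent if and only if $N\models x\in y\wedge y\in x$. For a model $M$ of $\mathsf{ZFC}$, a graph in $M$ consists of elements $V,E\in M$ such that $M\models$ "$E\subseteq V\times V$ is a symmetric relation on $V$" (with Kuratowski pairs); it is identified with the graph whose vertices are the $x\in M$ with $M\models x\in V$, and in which $x,y$ are adjacent if and only if $M\models (x,y)\in E$. Proposition. Let $M\models\mathsf{ZFC}$ and let $G$ be a graph in $M$. Then there is a model $N$ of $\mathsf{ZFC}$ without Foundation (that is, of the axioms of $\mathsf{ZFC}$ other than the Axiom of Foundation) such that $N_1$ is isomorphic to the disjoint union of $G$ with infinitely many isolated vertices, i.e. points without any edges or self-loops. -/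

import Mathlib

open FirstOrder FirstOrder.Language

universe u

namespace DoubleMembership

/-! ## The language of set theory and the axioms of ZFC -/

/-- The relation symbols of the language of set theory: one binary symbol. -/
inductive SetRel : ℕ → Type
  | mem : SetRel 2

/-- The first-order language of set theory, whose only symbol is the binary relation `∈`. -/
def setLang : FirstOrder.Language.{0, 0} := ⟨fun _ => Empty, SetRel⟩

/-- The symbol `∈`. -/
abbrev memSymb : setLang.Relations 2 := SetRel.mem

/-! Sentences are written with de Bruijn levels: the outermost quantifier binds variable `0`, the
next one variable `1`, and so on. -/

/-- The atomic formula `xᵢ ∈ xⱼ`. -/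
abbrev memF {n : ℕ} (i j : Fin n) : setLang.BoundedFormula Empty n :=
  memSymb.boundedFormula₂ (Term.var (Sum.inr i)) (Term.var (Sum.inr j))

/-- The atomic formula `xᵢ = xⱼ`. -/
abbrev eqF {n : ℕ} (i j : Fin n) : setLang.BoundedFormula Empty n :=
  Term.bdEqual (Term.var (Sum.inr i)) (Term.var (Sum.inr j))

/-- `∀ x y, (∀ z, z ∈ x ↔ z ∈ y) → x = y`. -/
def extensionality : setLang.Sentence :=
  ∀' ∀' ((∀' (memF 2 0 ⇔ memF 2 1)) ⟹ eqF 0 1)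

/-- `∀ a, (∃ x, x ∈ a) → ∃ x, x ∈ a ∧ ∀ y, y ∈ x → y ∉ a`. -/
def foundation : setLang.Sentence :=
  ∀' ((∃' memF 1 0) ⟹ ∃' (memF 1 0 ⊓ ∀' (memF 2 1 ⟹ ∼(memF 2 0))))

/-- `∀ x y, ∃ p, ∀ z, z ∈ p ↔ z = x ∨ z = y`. -/
def pairing : setLang.Sentence :=
  ∀' ∀' ∃' ∀' (memF 3 2 ⇔ (eqF 3 0 ⊔ eqF 3 1))

/-- `∀ a, ∃ u, ∀ x, x ∈ u ↔ ∃ y, y ∈ a ∧ x ∈ y`. -/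
def union : setLang.Sentence :=
  ∀' ∃' ∀' (memF 2 1 ⇔ ∃' (memF 3 0 ⊓ memF 2 3))

/-- `∀ a, ∃ p, ∀ x, x ∈ p ↔ ∀ y, y ∈ x → y ∈ a`. -/
def powerSet : setLang.Sentence :=
  ∀' ∃' ∀' (memF 2 1 ⇔ ∀' (memF 3 2 ⟹ memF 3 0))

/-- `∃ a, (∃ e, e ∈ a ∧ ∀ x, x ∉ e) ∧ ∀ x, x ∈ a → ∃ y, y ∈ a ∧ ∀ z, z ∈ y ↔ z ∈ x ∨ z = x`. -/
def infinity : setLang.Sentence :=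
  ∃' ((∃' (memF 1 0 ⊓ ∀' ∼(memF 2 1))) ⊓
    ∀' (memF 1 0 ⟹ ∃' (memF 2 0 ⊓ ∀' (memF 3 2 ⇔ (memF 3 1 ⊔ eqF 3 1)))))

/-- Every set `a` of non-empty, pairwise disjoint sets has a transversal `c`:
`∀ a, (∀ x, x ∈ a → ∃ y, y ∈ x) ∧
  (∀ x y, x ∈ a ∧ y ∈ a ∧ (∃ z, z ∈ x ∧ z ∈ y) → x = y) →
  ∃ c, ∀ x, x ∈ a → ∃ z, ∀ w, (w ∈ c ∧ w ∈ x) ↔ w = z`. -/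
def choice : setLang.Sentence :=
  ∀' (((∀' (memF 1 0 ⟹ ∃' memF 2 1)) ⊓
      (∀' ∀' ((memF 1 0 ⊓ memF 2 0 ⊓ ∃' (memF 3 1 ⊓ memF 3 2)) ⟹ eqF 1 2))) ⟹
    ∃' ∀' (memF 2 0 ⟹ ∃' ∀' ((memF 4 1 ⊓ memF 4 2) ⇔ eqF 4 3)))

/-- For a formula `φ` with parameters `p₀, …, pₙ₋₁` and `k` further free variables, the formula
`φ` in which `pᵢ` is read as the bound variable `i` and the `j`-th further variable is read as the
bound variable `e j`. -/
def plug {n k m : ℕ} (φ : setLang.Formula (Fin n ⊕ Fin k)) (e : Fin k → Fin (n + m)) :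
    setLang.BoundedFormula Empty (n + m) :=
  BoundedFormula.relabel (k := 0)
    (Sum.elim (fun i => Sum.inr (Fin.castAdd m i)) (fun j => Sum.inr (e j)) :
      Fin n ⊕ Fin k → Empty ⊕ Fin (n + m)) φ

/-- After the parameters `p₀, …, pₙ₋₁`, which are the bound variables `0, …, n - 1`, the `i`-th
bound variable counted from `0`, where `m` variables are bound after the parameters. -/
abbrev bv (n m : ℕ) (i : Fin m) : Fin (n + m) := Fin.natAdd n i

/-- The instance of the Separation schema given by a formula `φ(p₀, …, pₙ₋₁, x)`:
`∀ p₀ … pₙ₋₁ a, ∃ b, ∀ x, x ∈ b ↔ x ∈ a ∧ φ(p, x)`. -/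
def separation {n : ℕ} (φ : setLang.Formula (Fin n ⊕ Fin 1)) : setLang.Sentence :=
  BoundedFormula.alls (n := n + 1)
    (∃' ∀' (memF (bv n 3 2) (bv n 3 1) ⇔
      (memF (bv n 3 2) (bv n 3 0) ⊓ plug (m := 3) φ ![bv n 3 2])))

/-- The instance of the Replacement schema given by a formula `φ(p₀, …, pₙ₋₁, x, y)`:
`∀ p₀ … pₙ₋₁ a, (∀ x y z, x ∈ a ∧ φ(p, x, y) ∧ φ(p, x, z) → y = z) →
  ∃ b, ∀ y, y ∈ b ↔ ∃ x, x ∈ a ∧ φ(p, x, y)`. -/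
def replacement {n : ℕ} (φ : setLang.Formula (Fin n ⊕ Fin 2)) : setLang.Sentence :=
  BoundedFormula.alls (n := n + 1)
    ((∀' ∀' ∀' ((memF (bv n 4 1) (bv n 4 0) ⊓ plug (m := 4) φ ![bv n 4 1, bv n 4 2] ⊓
        plug (m := 4) φ ![bv n 4 1, bv n 4 3]) ⟹ eqF (bv n 4 2) (bv n 4 3))) ⟹
      ∃' ∀' (memF (bv n 3 2) (bv n 3 1) ⇔
        ∃' (memF (bv n 4 3) (bv n 4 0) ⊓ plug (m := 4) φ ![bv n 4 3, bv n 4 2])))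

/-- The theory obtained from ZFC by dropping the Axiom of Foundation. -/
def ZFCWithoutFoundation : setLang.Theory :=
  {extensionality, pairing, union, powerSet, infinity, choice} ∪
    {σ | ∃ (n : ℕ) (φ : setLang.Formula (Fin n ⊕ Fin 1)), σ = separation φ} ∪
    {σ | ∃ (n : ℕ) (φ : setLang.Formula (Fin n ⊕ Fin 2)), σ = replacement φ}

/-- The theory ZFC. -/
def ZFC : setLang.Theory := insert foundation ZFCWithoutFoundation

/-! ## Graphs, double-membership graphs, and graphs in a model -/

/-- A graph: a set with a symmetric binary relation, which need not be irreflexive. -/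
structure LoopGraph (V : Type u) where
  Adj : V → V → Prop
  symm : ∀ x y, Adj x y → Adj y x

/-- The disjoint union of a graph with a set `I` of isolated vertices
(no edges at them, no self-loops). -/
def LoopGraph.addIsolated {V : Type u} (G : LoopGraph V) (I : Type u) : LoopGraph (V ⊕ I) where
  Adj := Sum.LiftRel G.Adj (fun _ _ => False)
  symm := by
    rintro _ _ (h | h)
    · exact .inl (G.symm _ _ h)
    · exact h.elim

/-- Isomorphism of graphs. -/
def LoopGraph.Iso {V W : Type u} (G : LoopGraph V) (H : LoopGraph W) : Prop :=
  Nonempty (RelIso G.Adj H.Adj)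

section Model

variable {M : Type u} [setLang.Structure M]

/-- `M ⊨ x ∈ y`. -/
def Mem (x y : M) : Prop := Structure.RelMap memSymb ![x, y]

variable (M) in
/-- The double-membership graph (D-graph) of an `∈`-structure `M`: its vertices are the elements of
`M`, and `x`, `y` are adjacent iff `M ⊨ x ∈ y ∧ y ∈ x`. -/
def dGraph : LoopGraph M where
  Adj x y := Mem x y ∧ Mem y x
  symm _ _ h := ⟨h.2, h.1⟩

/-- `M ⊨ s = {x, y}`. -/
def IsPair (s x y : M) : Prop := ∀ z, Mem z s ↔ z = x ∨ z = y

/-- `M ⊨ p = (x, y)`, where `(x, y) = {{x}, {x, y}}` is the Kuratowski pair. -/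
def IsOrderedPair (p x y : M) : Prop := ∀ z, Mem z p ↔ IsPair z x x ∨ IsPair z x y

variable (M) in
/-- A graph in the sense of `M`: elements `dom` and `edges` of `M` such that, in `M`, `edges` is a
symmetric subset of `dom × dom`. -/
structure InternalGraph where
  dom : M
  edges : M
  edges_subset : ∀ p, Mem p edges → ∃ x y, Mem x dom ∧ Mem y dom ∧ IsOrderedPair p x y
  edges_symm : ∀ x y, (∃ p, Mem p edges ∧ IsOrderedPair p x y) →
    ∃ q, Mem q edges ∧ IsOrderedPair q y x

/-- The actual graph given by a graph in the sense of `M`: its vertices are the `x` with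
`M ⊨ x ∈ dom`, and `x`, `y` are adjacent iff `M ⊨ (x, y) ∈ edges`. -/
def InternalGraph.toGraph (G : InternalGraph M) : LoopGraph {x : M // Mem x G.dom} where
  Adj x y := ∃ p, Mem p G.edges ∧ IsOrderedPair p x.1 y.1
  symm x y := G.edges_symm x.1 y.1

end Model

end DoubleMembership

/-! A Rieger–Bernays permutation argument. If `π` is a definable permutation of `M`, the relation
`x ∈ π y` satisfies every axiom of `ZFC` except Foundation: a class is a set for the new relation
iff it is one for the old relation. For Infinity it suffices that `π` fixes the members of some
inductive set, which holds if `π` fixes every transitive set.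

Let `V` be the vertex set of `G`. Choose definable codes `A v` of the vertices, none of which has
another code as a member, and sets `B v` whose members are the codes of the neighbors of `v` and one
further set that determines `v`. If `π` exchanges `A v` with `B v` for all `v ∈ V` and fixes
everything else, then `A v` is a member of `A w` in the new sense iff `A v ∈ B w`, that is, iff `v`
and `w` are adjacent. With `A v = {{V}, v}` and the further set `{{{V}}, v}`, every other double
membership of the new relation would give an `∈`-cycle in `M`, so that the sets which are not codes
of vertices are isolated. -/

namespace DoubleMembership

section Definability

open Set

variable {L L' : Language} {M : Type*} [L.Structure M] [L'.Structure M] {A : Set M} {α β γ : Type*}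

theorem definable_univ_iff_exists_params {S : Set (α → M)} :
    univ.Definable L S ↔
      ∃ (k : ℕ) (p : Fin k → M) (φ : L.Formula (Fin k ⊕ α)),
        S = {v | φ.Realize (Sum.elim p v)} := by
  constructor
  · intro hS
    obtain ⟨A₀, -, hA₀⟩ := definable_iff_finitely_definable.1 hS
    obtain ⟨φ, rfl⟩ := definable_iff_exists_formula_sum.1 hA₀
    refine ⟨A₀.card, fun i => A₀.equivFin.symm i, φ.relabel (Sum.map A₀.equivFin id), ?_⟩
    ext v
    simp only [mem_ofPred_eq, Formula.realize_relabel, Sum.elim_comp_map, Function.comp_id]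
    congr! 2
    ext a
    exact congrArg Subtype.val (A₀.equivFin.symm_apply_apply a).symm
  · rintro ⟨k, p, φ, rfl⟩
    refine definable_iff_exists_formula_sum.2
      ⟨φ.relabel (Sum.map (fun i => ⟨p i, mem_univ _⟩) id), ?_⟩
    ext v
    simp only [mem_ofPred_eq, Formula.realize_relabel, Sum.elim_comp_map, Function.comp_id]
    rfl

theorem definableFun_comp_right {s : (α → M) → M} (hs : A.DefinableFun L s) (f : α → β) :
    A.DefinableFun L fun w : β → M => s (w ∘ f) :=
  Definable.preimage_comp (Option.map f) hs

theorem definable_forall {R : (α → M) → M → Prop}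
    (hR : A.Definable L {w : Option α → M | R (w ∘ some) (w none)}) :
    A.Definable L {v | ∀ x, R v x} := by
  convert! (hR.preimage_comp (fun o : Option α => o.elim (Sum.inr ()) Sum.inl)).forall_of_finite
    using 1
  ext v
  exact ⟨fun h u => h (u ()), fun h x => h fun _ => x⟩

theorem definable_exists {R : (α → M) → M → Prop}
    (hR : A.Definable L {w : Option α → M | R (w ∘ some) (w none)}) :
    A.Definable L {v | ∃ x, R v x} := by
  convert! (hR.preimage_comp (fun o : Option α => o.elim (Sum.inr ()) Sum.inl)).exists_of_finite
    using 1
  ext v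
  exact ⟨fun ⟨x, h⟩ => ⟨fun _ => x, h⟩, fun ⟨u, h⟩ => ⟨u (), h⟩⟩

theorem definableFun_term_realize
    (hfun : ∀ {n : ℕ} (f : L.Functions n), A.DefinableFun L' (Structure.funMap (M := M) f))
    (t : L.Term γ) {s : γ → (α → M) → M} (hs : ∀ c, A.DefinableFun L' (s c)) :
    A.DefinableFun L' fun v => t.realize fun c => s c v := by
  induction t with
  | var c => exact hs c
  | func f ts ih => exact .comp (g := fun v i => (ts i).realize fun c => s c v) ih (hfun f)

theorem definable_boundedFormula_realize
    (hfun : ∀ {n : ℕ} (f : L.Functions n), A.DefinableFun L' (Structure.funMap (M := M) f))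
    (hrel : ∀ {n : ℕ} (R : L.Relations n), A.Definable L' {v : Fin n → M | Structure.RelMap R v})
    {n : ℕ} (φ : L.BoundedFormula γ n) {s : γ → (α → M) → M} {x : Fin n → (α → M) → M}
    (hs : ∀ c, A.DefinableFun L' (s c)) (hx : ∀ i, A.DefinableFun L' (x i)) :
    A.Definable L' {v | φ.Realize (fun c => s c v) fun i => x i v} := by
  induction φ generalizing α with
  | falsum => exact definable_empty
  | equal t₁ t₂ =>
    exact (definableFun_term_realize hfun t₁ (Sum.rec hs hx)).ofPred_eq
      (definableFun_term_realize hfun t₂ (Sum.rec hs hx))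
  | rel R ts =>
    exact (hrel R).preimage_map fun i => definableFun_term_realize hfun (ts i) (Sum.rec hs hx)
  | imp _ _ ih₁ ih₂ => exact (ih₁ hs hx).himp (ih₂ hs hx)
  | all _ ih =>
    let y : Fin (_ + 1) → (Option α → M) → M :=
      Fin.snoc (α := fun _ => (Option α → M) → M) (fun i w => x i (w ∘ some)) fun w => w none
    have hy i : A.DefinableFun L' (y i) := by
      cases i using Fin.lastCases with
      | last => simpa only [y, Fin.snoc_last] using DefinableFun.proj L'
      | cast i => simpa only [y, Fin.snoc_castSucc] using definableFun_comp_right (hx i) some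
    have y_apply w : (fun i => y i w) = Fin.snoc (fun i => x i (w ∘ some)) (w none) := by
      ext i
      cases i using Fin.lastCases <;> simp [y]
    have := ih (fun c => definableFun_comp_right (hs c) some) hy
    simp only [y_apply] at this
    exact definable_forall this

theorem definable_of_definable_symbols
    (hfun : ∀ {n : ℕ} (f : L.Functions n), A.DefinableFun L' (Structure.funMap (M := M) f))
    (hrel : ∀ {n : ℕ} (R : L.Relations n), A.Definable L' {v : Fin n → M | Structure.RelMap R v})
    {S : Set (α → M)} (hS : A.Definable L S) : A.Definable L' S := by
  obtain ⟨φ, rfl⟩ := definable_iff_exists_formula_sum.1 hS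
  convert! definable_boundedFormula_realize hfun hrel φ
    (s := Sum.elim (fun a _ => a) fun i v => v i) (x := Fin.elim0) ?_ finZeroElim using 1
  · ext v
    refine iff_of_eq (congrArg₂ (BoundedFormula.Realize φ) ?_ (Subsingleton.elim _ _))
    ext (a | i) <;> rfl
  · rintro (a | i)
    · exact definableFun_const L' α a.2
    · exact DefinableFun.proj L'

end Definability

section Axioms

open Set

variable {M : Type u} [setLang.Structure M]

/-- A class `S` of elements of `M` is internal if it is the class of members of an element of `M`,
i.e. if `M` thinks that `S` is a set. -/
def Internal (S : Set M) : Prop := ∃ b, ∀ x, Mem x b ↔ x ∈ S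

/-- `M ⊨ a` is an inductive set: it contains an empty set and is closed under `x ↦ x ∪ {x}`. -/
def IsInductive (a : M) : Prop :=
  (∃ e, Mem e a ∧ ∀ x, ¬ Mem x e) ∧
    ∀ x, Mem x a → ∃ y, Mem y a ∧ ∀ z, Mem z y ↔ Mem z x ∨ z = x

variable (M) in
/-- The axioms of ZFC without Foundation, read in `M`, with the schemas stated for the classes that
are definable in `M` with parameters. -/
structure SetAxioms : Prop where
  ext : ∀ x y : M, (∀ z, Mem z x ↔ Mem z y) → x = y
  pairing : ∀ x y : M, Internal {z | z = x ∨ z = y}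
  union : ∀ a : M, Internal {x | ∃ y, Mem y a ∧ Mem x y}
  powerSet : ∀ a : M, Internal {x | ∀ y, Mem y x → Mem y a}
  infinity : ∃ a : M, IsInductive a
  choice : ∀ a : M, (∀ x, Mem x a → ∃ y, Mem y x) →
    (∀ x y, Mem x a → Mem y a → (∃ z, Mem z x ∧ Mem z y) → x = y) →
    ∃ c, ∀ x, Mem x a → ∃ z, ∀ w, Mem w c ∧ Mem w x ↔ w = z
  separation : ∀ S : Set M, univ.Definable₁ setLang S → ∀ a, Internal {x | Mem x a ∧ x ∈ S}
  replacement : ∀ R : Set (M × M), univ.Definable₂ setLang R → ∀ a,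
    (∀ x y z, Mem x a → (x, y) ∈ R → (x, z) ∈ R → y = z) →
    Internal {y | ∃ x, Mem x a ∧ (x, y) ∈ R}

variable (M) in
/-- The axioms of ZFC, read in `M`. -/
structure ZFCAxioms : Prop extends SetAxioms M where
  foundation : ∀ a : M, (∃ x, Mem x a) → ∃ x, Mem x a ∧ ∀ y, Mem y x → ¬ Mem y a

theorem realize_memF {n : ℕ} (i j : Fin n) (v : Empty → M) (xs : Fin n → M) :
    (memF i j).Realize v xs ↔ Mem (xs i) (xs j) :=
  BoundedFormula.realize_rel₂

theorem realize_eqF {n : ℕ} (i j : Fin n) (v : Empty → M) (xs : Fin n → M) :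
    (eqF i j).Realize v xs ↔ xs i = xs j :=
  Iff.rfl

theorem realize_extensionality : M ⊨ extensionality ↔
    ∀ x y : M, (∀ z, Mem z x ↔ Mem z y) → x = y := by
  simp [extensionality, Sentence.Realize, Formula.Realize, Mem, Fin.snoc]

theorem realize_foundation : M ⊨ foundation ↔
    ∀ a : M, (∃ x, Mem x a) → ∃ x, Mem x a ∧ ∀ y, Mem y x → ¬ Mem y a := by
  simp [foundation, Sentence.Realize, Formula.Realize, Mem, Fin.snoc]

theorem realize_pairing : M ⊨ pairing ↔ ∀ x y : M, Internal {z | z = x ∨ z = y} := by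
  simp [pairing, Sentence.Realize, Formula.Realize, Mem, Fin.snoc, Internal]

theorem realize_union : M ⊨ union ↔ ∀ a : M, Internal {x | ∃ y, Mem y a ∧ Mem x y} := by
  simp [union, Sentence.Realize, Formula.Realize, Mem, Fin.snoc, Internal]

theorem realize_powerSet : M ⊨ powerSet ↔ ∀ a : M, Internal {x | ∀ y, Mem y x → Mem y a} := by
  simp [powerSet, Sentence.Realize, Formula.Realize, Mem, Fin.snoc, Internal]

theorem realize_infinity : M ⊨ infinity ↔ ∃ a : M, IsInductive a := by
  simp [infinity, Sentence.Realize, Formula.Realize, Mem, Fin.snoc, IsInductive]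

theorem realize_choice : M ⊨ choice ↔
    ∀ a : M, (∀ x, Mem x a → ∃ y, Mem y x) →
      (∀ x y, Mem x a → Mem y a → (∃ z, Mem z x ∧ Mem z y) → x = y) →
      ∃ c, ∀ x, Mem x a → ∃ z, ∀ w, Mem w c ∧ Mem w x ↔ w = z := by
  simp [choice, Sentence.Realize, Formula.Realize, Mem, Fin.snoc]

theorem realize_plug {n k m : ℕ} (φ : setLang.Formula (Fin n ⊕ Fin k)) (e : Fin k → Fin (n + m))
    (v : Empty → M) (p : Fin n → M) (q : Fin m → M) :
    (plug φ e).Realize v (Fin.append p q) ↔ φ.Realize (Sum.elim p (Fin.append p q ∘ e)) := by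
  refine BoundedFormula.realize_relabel.trans
    (iff_of_eq (congrArg₂ (BoundedFormula.Realize φ) ?_ (Subsingleton.elim _ _)))
  ext (i | i) <;> simp

theorem forall_append_singleton {α : Type*} {n : ℕ} {P : (Fin (n + 1) → α) → Prop} :
    (∀ xs, P xs) ↔ ∀ (p : Fin n → α) (a : α), P (Fin.append p ![a]) := by
  refine ⟨fun h p a => h _, fun h xs => ?_⟩
  have := h (Fin.init xs) (xs (Fin.last n))
  rwa [Fin.append_right_eq_snoc, Matrix.cons_val_zero, Fin.snoc_init_self] at this

theorem comp_vec_one {α β : Type*} (f : α → β) (a : α) : f ∘ ![a] = ![f a] :=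
  (FinVec.map_eq f ![a]).symm

theorem comp_vec_two {α β : Type*} (f : α → β) (a b : α) : f ∘ ![a, b] = ![f a, f b] :=
  (FinVec.map_eq f ![a, b]).symm

theorem realize_separation {n : ℕ} (φ : setLang.Formula (Fin n ⊕ Fin 1)) : M ⊨ separation φ ↔
    ∀ (p : Fin n → M) (a : M), Internal {x | Mem x a ∧ φ.Realize (Sum.elim p ![x])} := by
  rw [separation, Sentence.Realize, BoundedFormula.realize_alls, forall_append_singleton]
  simp only [BoundedFormula.realize_ex, BoundedFormula.realize_all, ← Fin.append_snoc,
    BoundedFormula.realize_iff, BoundedFormula.realize_inf, realize_memF, realize_plug,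
    comp_vec_one, Fin.append_right]
  rfl

theorem realize_replacement {n : ℕ} (φ : setLang.Formula (Fin n ⊕ Fin 2)) : M ⊨ replacement φ ↔
    ∀ (p : Fin n → M) (a : M),
      (∀ x y z, Mem x a → φ.Realize (Sum.elim p ![x, y]) → φ.Realize (Sum.elim p ![x, z]) →
        y = z) →
      Internal {y | ∃ x, Mem x a ∧ φ.Realize (Sum.elim p ![x, y])} := by
  rw [replacement, Sentence.Realize, BoundedFormula.realize_alls, forall_append_singleton]
  simp only [BoundedFormula.realize_imp, BoundedFormula.realize_ex, BoundedFormula.realize_all,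
    ← Fin.append_snoc, BoundedFormula.realize_iff, BoundedFormula.realize_inf, realize_memF,
    realize_eqF, realize_plug, comp_vec_two, Fin.append_right, and_imp]
  rfl

theorem models_separation_iff :
    M ⊨ {σ | ∃ (n : ℕ) (φ : setLang.Formula (Fin n ⊕ Fin 1)), σ = separation φ} ↔
      ∀ S : Set M, univ.Definable₁ setLang S → ∀ a, Internal {x | Mem x a ∧ x ∈ S} := by
  simp only [Theory.model_iff, mem_ofPred_eq, forall_exists_index, forall_comm (α := Sentence _),
    forall_eq, realize_separation]
  constructor
  · intro h S hS a
    obtain ⟨n, p, φ, hφ⟩ := definable_univ_iff_exists_params.1 hS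
    convert h n φ p a using 4 with x
    exact Set.ext_iff.1 hφ ![x]
  · intro h n φ p
    refine h {x | φ.Realize (Sum.elim p ![x])} (definable_univ_iff_exists_params.2 ⟨n, p, φ, ?_⟩)
    ext v
    exact iff_of_eq (congrArg (fun w => φ.Realize (Sum.elim p w)) (FinVec.etaExpand_eq v))

theorem models_replacement_iff :
    M ⊨ {σ | ∃ (n : ℕ) (φ : setLang.Formula (Fin n ⊕ Fin 2)), σ = replacement φ} ↔
      ∀ R : Set (M × M), univ.Definable₂ setLang R → ∀ a,
        (∀ x y z, Mem x a → (x, y) ∈ R → (x, z) ∈ R → y = z) →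
        Internal {y | ∃ x, Mem x a ∧ (x, y) ∈ R} := by
  simp only [Theory.model_iff, mem_ofPred_eq, forall_exists_index, forall_comm (α := Sentence _),
    forall_eq, realize_replacement]
  constructor
  · intro h R hR a
    obtain ⟨n, p, φ, hφ⟩ := definable_univ_iff_exists_params.1 hR
    have mem_R x y : (x, y) ∈ R ↔ φ.Realize (Sum.elim p ![x, y]) := Set.ext_iff.1 hφ ![x, y]
    simpa only [mem_R] using h n φ p a
  · intro h n φ p
    refine h {xy | φ.Realize (Sum.elim p ![xy.1, xy.2])}
      (definable_univ_iff_exists_params.2 ⟨n, p, φ, ?_⟩)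
    ext v
    exact iff_of_eq (congrArg (fun w => φ.Realize (Sum.elim p w)) (FinVec.etaExpand_eq v))

theorem models_ZFCWithoutFoundation_iff : M ⊨ ZFCWithoutFoundation ↔ SetAxioms M := by
  rw [ZFCWithoutFoundation, Theory.model_union_iff, Theory.model_union_iff,
    models_separation_iff, models_replacement_iff]
  simp only [Theory.model_insert_iff, Theory.model_singleton_iff, realize_extensionality,
    realize_pairing, realize_union, realize_powerSet, realize_infinity, realize_choice]
  exact ⟨fun ⟨⟨⟨h₁, h₂, h₃, h₄, h₅, h₆⟩, h₇⟩, h₈⟩ => ⟨h₁, h₂, h₃, h₄, h₅, h₆, h₇, h₈⟩,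
    fun ⟨h₁, h₂, h₃, h₄, h₅, h₆, h₇, h₈⟩ => ⟨⟨⟨h₁, h₂, h₃, h₄, h₅, h₆⟩, h₇⟩, h₈⟩⟩

theorem models_ZFC_iff : M ⊨ ZFC ↔ ZFCAxioms M := by
  rw [ZFC, Theory.model_insert_iff, realize_foundation, models_ZFCWithoutFoundation_iff]
  exact ⟨fun ⟨hf, h⟩ => ⟨h, hf⟩, fun h => ⟨h.foundation, h.toSetAxioms⟩⟩

end Axioms

section ClassFunctions

open Set

variable {M : Type u} [setLang.Structure M] {α : Type*}

theorem definable_mem {s t : (α → M) → M} (hs : univ.DefinableFun setLang s)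
    (ht : univ.DefinableFun setLang t) : univ.Definable setLang {v | Mem (s v) (t v)} := by
  have hmem : univ.Definable setLang {w : Fin 2 → M | Structure.RelMap memSymb w} :=
    Definable.mono (empty_definable_iff.2 ⟨memSymb.formula Term.var, by ext; simp⟩) (empty_subset _)
  refine hmem.preimage_map (F := fun v => ![s v, t v]) fun i => ?_
  fin_cases i
  exacts [hs, ht]

/-- `F` is a class function of `M`: its graph is definable with parameters. -/
def IsClassFunction (F : M → M) : Prop :=
  univ.DefinableFun setLang fun v : Unit → M => F (v ())

/-- `F` is a binary class function of `M`: its graph is definable with parameters. -/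
def IsClassFunction₂ (F : M → M → M) : Prop :=
  univ.DefinableFun setLang fun v : Fin 2 → M => F (v 0) (v 1)

theorem IsClassFunction.comp {F : M → M} (hF : IsClassFunction F) {s : (α → M) → M}
    (hs : univ.DefinableFun setLang s) : univ.DefinableFun setLang fun v => F (s v) :=
  DefinableFun.comp (g := fun v _ => s v) (fun _ => hs) hF

theorem IsClassFunction₂.comp {F : M → M → M} (hF : IsClassFunction₂ F) {s t : (α → M) → M}
    (hs : univ.DefinableFun setLang s) (ht : univ.DefinableFun setLang t) :
    univ.DefinableFun setLang fun v => F (s v) (t v) := by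
  refine DefinableFun.comp (g := fun v => ![s v, t v]) (fun i => ?_) hF
  fin_cases i
  exacts [hs, ht]

theorem IsClassFunction.definable₂_graph {F : M → M} (hF : IsClassFunction F) :
    univ.Definable₂ setLang {xy : M × M | xy.2 = F xy.1} :=
  (DefinableFun.proj setLang).ofPred_eq (hF.comp (DefinableFun.proj setLang))

theorem IsClassFunction.symm {π : Equiv.Perm M} (hπ : IsClassFunction π) :
    IsClassFunction π.symm := by
  have graph_eq : (fun v : Unit → M => π.symm (v ())).tupleGraph =
      {w | π (w none) = w (some ())} := by
    ext w
    exact π.symm_apply_eq.trans eq_comm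
  rw [IsClassFunction, DefinableFun, graph_eq]
  exact (hπ.comp (DefinableFun.proj setLang)).ofPred_eq (DefinableFun.proj setLang)

theorem internal_members (a : M) : Internal {x | Mem x a} :=
  ⟨a, fun _ => Iff.rfl⟩

theorem SetAxioms.internal_image (hM : SetAxioms M) {F : M → M} (hF : IsClassFunction F)
    {S : Set M} (hS : Internal S) : Internal (F '' S) := by
  obtain ⟨a, ha⟩ := hS
  convert hM.replacement _ hF.definable₂_graph a fun x y z _ hy hz => hy.trans hz.symm using 1
  ext y
  simp [ha, eq_comm]

theorem SetAxioms.internal_sUnion (hM : SetAxioms M) {S : Set M} (hS : Internal S) :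
    Internal {x | ∃ y ∈ S, Mem x y} := by
  obtain ⟨a, ha⟩ := hS
  simpa only [ha] using hM.union a

end ClassFunctions

section PermModel

open Set

variable {M : Type u}

/-- The Rieger–Bernays model of a permutation `π` of an `∈`-structure `M`: the elements are those
of `M`, and `x` is a member of `y` if `M ⊨ x ∈ π y`. -/
def PermModel (_π : Equiv.Perm M) : Type u := M

variable [setLang.Structure M] {π : Equiv.Perm M}

instance PermModel.instStructure (π : Equiv.Perm M) : setLang.Structure (PermModel π) where
  funMap f := f.elim
  RelMap
    | .mem, v => Mem (M := M) (v 0) (π (v 1))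

namespace PermModel

theorem mem_iff {x y : M} : Mem (M := PermModel π) x y ↔ Mem x (π y) :=
  Iff.rfl

theorem internal_iff {S : Set M} : Internal (M := PermModel π) S ↔ Internal S :=
  (π.surjective.exists (p := fun b => ∀ x, Mem x b ↔ x ∈ S)).symm

theorem definable (hπ : IsClassFunction π) {α : Type*} {S : Set (α → M)}
    (hS : univ.Definable (M := PermModel π) setLang S) : univ.Definable setLang S := by
  refine @definable_of_definable_symbols setLang setLang M (instStructure π) _ univ α
    (fun f => f.elim) ?_ S hS
  rintro _ ⟨⟩
  exact definable_mem (DefinableFun.proj _) (hπ.comp (DefinableFun.proj _))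

theorem isInductive {a : M} (ha : IsInductive (π a)) (hfix : ∀ x, Mem x (π a) → π x = x) :
    IsInductive (M := PermModel π) a := by
  obtain ⟨⟨e, hea, he⟩, hsucc⟩ := ha
  have mem_iff_of_mem {x y : M} (hy : Mem y (π a)) : Mem (M := PermModel π) x y ↔ Mem x y := by
    rw [mem_iff, hfix y hy]
  refine ⟨⟨e, hea, fun x => (mem_iff_of_mem hea).not.2 (he x)⟩, fun x hx => ?_⟩
  obtain ⟨y, hy, hyx⟩ := hsucc x hx
  exact ⟨y, hy, fun z =>
    (mem_iff_of_mem hy).trans ((hyx z).trans (or_congr_left (mem_iff_of_mem hx).symm))⟩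

theorem choice (hM : SetAxioms M) (hπ : IsClassFunction π) (a : PermModel π)
    (hne : ∀ x, Mem x a → ∃ y, Mem y x)
    (hdisj : ∀ x y, Mem x a → Mem y a → (∃ z, Mem z x ∧ Mem z y) → x = y) :
    ∃ c, ∀ x, Mem x a → ∃ z, ∀ w, Mem w c ∧ Mem w x ↔ w = z := by
  obtain ⟨b, hb⟩ := hM.internal_image hπ (internal_members (π a))
  have b_nonempty : ∀ x, Mem x b → ∃ y, Mem y x := by
    simpa only [hb, forall_mem_image] using! hne
  have b_disjoint : ∀ x y, Mem x b → Mem y b → (∃ z, Mem z x ∧ Mem z y) → x = y := by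
    simp only [hb]
    rintro _ _ ⟨x, hx, rfl⟩ ⟨y, hy, rfl⟩ h
    exact congrArg π (hdisj x y hx hy h)
  obtain ⟨c, hc⟩ := hM.choice b b_nonempty b_disjoint
  simp only [hb, forall_mem_image] at hc
  obtain ⟨c, rfl⟩ := π.surjective c
  exact ⟨c, hc⟩

theorem setAxioms (hM : SetAxioms M) (hπ : IsClassFunction π)
    (hfix : ∃ a : M, IsInductive a ∧ ∀ x, Mem x a → π x = x) : SetAxioms (PermModel π) where
  ext x y h := π.injective (hM.ext (π x) (π y) h)
  pairing x y := (internal_iff (M := M)).2 (hM.pairing x y)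
  union a := (internal_iff (M := M)).2 <| by
    have := hM.internal_sUnion (hM.internal_image hπ (internal_members (π a)))
    simpa only [mem_image, mem_ofPred_eq, exists_exists_and_eq_and] using! this
  powerSet a := (internal_iff (M := M)).2 <| by
    have := hM.internal_image hπ.symm (hM.powerSet (π a))
    rwa [π.image_symm_eq_preimage] at this
  infinity := by
    obtain ⟨a, ha, hfix⟩ := hfix
    obtain ⟨a, rfl⟩ := π.surjective a
    exact ⟨a, isInductive ha hfix⟩
  choice := choice hM hπ
  separation S hS a := (internal_iff (M := M)).2 (hM.separation S (definable hπ hS) (π a))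
  replacement R hR a hfun := (internal_iff (M := M)).2
    (hM.replacement R (definable hπ hR) (π a) hfun)

end PermModel

end PermModel

section Exchange

open Function

variable {ι α : Type*} {f g : ι → α} {x y : α}

/-- The map that exchanges `f i` and `g i` for every `i` and fixes everything else. It does so if
`f` and `g` are injective with disjoint ranges. -/
noncomputable def exchange (f g : ι → α) : α → α :=
  extend f g (extend g f id)

theorem exchange_apply_left (hf : Injective f) (i : ι) : exchange f g (f i) = g i :=
  hf.extend_apply _ _ i

theorem exchange_apply_right (hg : Injective g) (hfg : ∀ i j, f i ≠ g j) (i : ι) :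
    exchange f g (g i) = f i := by
  rw [exchange, extend_apply' _ _ _ fun ⟨j, hj⟩ => hfg j i hj, hg.extend_apply]

theorem exchange_apply_of_ne (hf : ∀ i, f i ≠ x) (hg : ∀ i, g i ≠ x) : exchange f g x = x := by
  rw [exchange, extend_apply' _ _ _ fun ⟨i, hi⟩ => hf i hi,
    extend_apply' _ _ _ fun ⟨i, hi⟩ => hg i hi, id]

theorem exchange_cases (f g : ι → α) (x : α) :
    (∃ i, f i = x) ∨ (∃ i, g i = x) ∨ ((∀ i, f i ≠ x) ∧ ∀ i, g i ≠ x) := by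
  simp only [ne_eq, ← not_exists]
  tauto

theorem exchange_involutive (hf : Injective f) (hg : Injective g) (hfg : ∀ i j, f i ≠ g j) :
    Involutive (exchange f g) := by
  intro x
  obtain ⟨i, rfl⟩ | ⟨i, rfl⟩ | ⟨hfx, hgx⟩ := exchange_cases f g x
  · rw [exchange_apply_left hf, exchange_apply_right hg hfg]
  · rw [exchange_apply_right hg hfg, exchange_apply_left hf]
  · rw [exchange_apply_of_ne hfx hgx, exchange_apply_of_ne hfx hgx]

theorem exchange_eq_iff (hf : Injective f) (hg : Injective g) (hfg : ∀ i j, f i ≠ g j) :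
    exchange f g x = y ↔ (∃ i, f i = x ∧ g i = y) ∨ (∃ i, g i = x ∧ f i = y) ∨
      ((∀ i, f i ≠ x) ∧ ∀ i, g i ≠ x) ∧ x = y := by
  constructor
  · rintro rfl
    obtain ⟨i, rfl⟩ | ⟨i, rfl⟩ | h := exchange_cases f g x
    · exact .inl ⟨i, rfl, (exchange_apply_left hf i).symm⟩
    · exact .inr (.inl ⟨i, rfl, (exchange_apply_right hg hfg i).symm⟩)
    · exact .inr (.inr ⟨h, (exchange_apply_of_ne h.1 h.2).symm⟩)
  · rintro (⟨i, rfl, rfl⟩ | ⟨i, rfl, rfl⟩ | ⟨⟨hfx, hgx⟩, rfl⟩)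
    exacts [exchange_apply_left hf i, exchange_apply_right hg hfg i, exchange_apply_of_ne hfx hgx]

/-- The permutation of `α` given by `exchange f g`. -/
noncomputable def exchangePerm (hf : Injective f) (hg : Injective g) (hfg : ∀ i j, f i ≠ g j) :
    Equiv.Perm α :=
  (exchange_involutive hf hg hfg).toPerm

theorem rel_exchange_and_iff {r : α → α → Prop} (hr : ∀ x y, r x y → ¬ r y x)
    (hf : Injective f) (hg : Injective g) (hfg : ∀ i j, f i ≠ g j)
    (hff : ∀ i j, ¬ r (f i) (f j)) (hgf : ∀ i j, ¬ r (g i) (f j))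
    (hfix₁ : ∀ i y, r (g i) y → ¬ r y (f i)) (hfix₂ : ∀ i y, r (f i) y → ¬ r y (g i)) :
    r x (exchange f g y) ∧ r y (exchange f g x) ↔
      Relation.Map (fun i j => r (f i) (g j) ∧ r (f j) (g i)) f f x y := by
  constructor
  · rintro ⟨hxy, hyx⟩
    obtain ⟨i, rfl⟩ | ⟨i, rfl⟩ | ⟨hfx, hgx⟩ := exchange_cases f g x
    · rw [exchange_apply_left hf] at hyx
      obtain ⟨j, rfl⟩ | ⟨j, rfl⟩ | ⟨hfy, hgy⟩ := exchange_cases f g y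
      · rw [exchange_apply_left hf] at hxy
        exact ⟨i, j, ⟨hxy, hyx⟩, rfl, rfl⟩
      · rw [exchange_apply_right hg hfg] at hxy
        exact (hff i j hxy).elim
      · rw [exchange_apply_of_ne hfy hgy] at hxy
        exact (hfix₂ i y hxy hyx).elim
    · rw [exchange_apply_right hg hfg] at hyx
      obtain ⟨j, rfl⟩ | ⟨j, rfl⟩ | ⟨hfy, hgy⟩ := exchange_cases f g y
      · exact (hff j i hyx).elim
      · exact (hgf j i hyx).elim
      · rw [exchange_apply_of_ne hfy hgy] at hxy
        exact (hfix₁ i y hxy hyx).elim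
    · rw [exchange_apply_of_ne hfx hgx] at hyx
      obtain ⟨j, rfl⟩ | ⟨j, rfl⟩ | ⟨hfy, hgy⟩ := exchange_cases f g y
      · rw [exchange_apply_left hf] at hxy
        exact (hfix₂ j x hyx hxy).elim
      · rw [exchange_apply_right hg hfg] at hxy
        exact (hfix₁ j x hyx hxy).elim
      · rw [exchange_apply_of_ne hfy hgy] at hxy
        exact (hr x y hxy hyx).elim
  · rintro ⟨i, j, h, rfl, rfl⟩
    rwa [exchange_apply_left hf, exchange_apply_left hf]

end Exchange

section Graphs

open Function Set

theorem LoopGraph.iso_addIsolated {V W : Type u} {G : LoopGraph V} {H : LoopGraph W} {f : V → W}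
    (hf : Injective f) (hH : ∀ x y, H.Adj x y ↔ Relation.Map G.Adj f f x y) :
    H.Iso (G.addIsolated ↥(range f)ᶜ) := by
  classical
  let e : V ⊕ ↥(range f)ᶜ ≃ W :=
    ((Equiv.ofInjective f hf).sumCongr (Equiv.refl _)).trans (Equiv.Set.sumCompl (range f))
  refine ⟨RelIso.symm ⟨e, ?_⟩⟩
  have adj_right (i : ↥(range f)ᶜ) (y : W) : ¬ H.Adj i y := fun h => by
    obtain ⟨v, w, -, hv, -⟩ := (hH _ _).1 h
    exact i.2 ⟨v, hv⟩
  rintro (v | i) (w | j)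
  · exact (hH _ _).trans ((Relation.map_apply_apply hf hf _ _ _).trans Sum.liftRel_inl_inl.symm)
  · exact iff_of_false (fun h => adj_right j _ (H.symm _ _ h)) Sum.not_liftRel_inl_inr
  · exact iff_of_false (adj_right i _) Sum.not_liftRel_inr_inl
  · exact iff_of_false (adj_right i _) fun h => Sum.liftRel_inr_inr.1 h

end Graphs

section Sets

open Set

variable {M : Type u} [setLang.Structure M] {α : Type*}

namespace SetAxioms

variable (hM : SetAxioms M)

/-- The unordered pair `{x, y}` formed in `M`. -/
noncomputable def pair (x y : M) : M := (hM.pairing x y).choose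

theorem mem_pair_iff {x y z : M} : Mem z (hM.pair x y) ↔ z = x ∨ z = y :=
  (hM.pairing x y).choose_spec z

theorem mem_pair_left (x y : M) : Mem x (hM.pair x y) :=
  hM.mem_pair_iff.2 (.inl rfl)

theorem mem_pair_right (x y : M) : Mem y (hM.pair x y) :=
  hM.mem_pair_iff.2 (.inr rfl)

theorem pair_right_injective (x : M) : Function.Injective (hM.pair x) := by
  intro y z h
  have hy := hM.mem_pair_iff.1 (h ▸ hM.mem_pair_right x y)
  have hz := hM.mem_pair_iff.1 (h ▸ hM.mem_pair_right x z)
  grind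

theorem eq_and_eq_of_pair_eq_pair_self {x y z : M} (h : hM.pair x y = hM.pair z z) :
    x = z ∧ y = z := by
  have hx := hM.mem_pair_left x y
  have hy := hM.mem_pair_right x y
  rw [h, hM.mem_pair_iff, or_self] at hx hy
  exact ⟨hx, hy⟩

theorem isPair_iff {s x y : M} : IsPair s x y ↔ s = hM.pair x y := by
  refine ⟨fun h => hM.ext _ _ fun z => (h z).trans hM.mem_pair_iff.symm, ?_⟩
  rintro rfl z
  exact hM.mem_pair_iff

theorem isOrderedPair_iff {p x y : M} :
    IsOrderedPair p x y ↔ p = hM.pair (hM.pair x x) (hM.pair x y) := by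
  simp only [← isPair_iff, IsOrderedPair, IsPair]

include hM in
theorem definableFun_of_mem_iff {F : (α → M) → M} {R : (α → M) → M → Prop}
    (hF : ∀ v z, Mem z (F v) ↔ R v z)
    (hR : univ.Definable setLang {w : Option α → M | R (w ∘ some) (w none)}) :
    univ.DefinableFun setLang F := by
  have graph_eq : F.tupleGraph = {w | ∀ z, Mem z (w none) ↔ R (w ∘ some) z} := by
    ext w
    simp only [← hF]
    exact ⟨fun h z => by rw [← h], fun h => hM.ext _ _ fun z => (h z).symm⟩
  rw [DefinableFun, graph_eq]
  have mem_definable :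
      univ.Definable setLang {w : Option (Option α) → M | Mem (w none) (w (some none))} :=
    definable_mem (.proj _) (.proj _)
  have rel_definable :
      univ.Definable setLang {w : Option (Option α) → M | R (w ∘ some ∘ some) (w none)} :=
    hR.preimage_comp (Option.map some)
  simp only [iff_iff_implies_and_implies]
  exact definable_forall ((mem_definable.himp rel_definable).inter
    (rel_definable.himp mem_definable))

theorem isClassFunction₂_pair : IsClassFunction₂ hM.pair :=
  hM.definableFun_of_mem_iff (fun _ _ => hM.mem_pair_iff) <|
    ((DefinableFun.proj _).ofPred_eq (DefinableFun.proj _)).union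
      ((DefinableFun.proj _).ofPred_eq (DefinableFun.proj _))

include hM in
theorem internal_singleton (x : M) : Internal {x} :=
  ⟨hM.pair x x, fun _ => hM.mem_pair_iff.trans or_self_iff⟩

include hM in
theorem internal_union {S T : Set M} (hS : Internal S) (hT : Internal T) : Internal (S ∪ T) := by
  obtain ⟨a, ha⟩ := hS
  obtain ⟨b, hb⟩ := hT
  convert hM.union (hM.pair a b) using 1
  ext x
  simp [hM.mem_pair_iff, ha, hb]

include hM in
theorem internal_of_finite {S : Set M} (hS : S.Finite) : Internal S := by
  induction S, hS using Set.Finite.induction_on with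
  | empty =>
    obtain ⟨_, ⟨e, -, he⟩, -⟩ := hM.infinity
    exact ⟨e, fun x => iff_of_false (he x) (notMem_empty x)⟩
  | insert _ _ ih => exact hM.internal_union (hM.internal_singleton _) ih

end SetAxioms

theorem exists_finite_of_transGen_self {β : Type*} {r : β → β → Prop} {x : β}
    (hx : Relation.TransGen r x x) :
    ∃ S : Set β, S.Finite ∧ S.Nonempty ∧ ∀ y ∈ S, ∃ z ∈ S, r z y := by
  have path : ∀ y, Relation.TransGen r x y → ∃ S : Set β, S.Finite ∧ (∃ z ∈ S, r z y) ∧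
      ∀ w ∈ S, w = x ∨ ∃ z ∈ S, r z w := by
    intro y hy
    induction hy with
    | single hy => exact ⟨{x}, by simp, by simpa using hy, by simp⟩
    | @tail b c _ hbc ih =>
      obtain ⟨S, hS, ⟨z, hz, hzb⟩, hpred⟩ := ih
      refine ⟨insert b S, hS.insert b, ⟨b, by simp, hbc⟩, ?_⟩
      rintro w (rfl | hw)
      · exact .inr ⟨z, .inr hz, hzb⟩
      · exact (hpred w hw).imp id fun ⟨u, hu, huw⟩ => ⟨u, .inr hu, huw⟩
  obtain ⟨S, hS, ⟨z, hz, hzx⟩, hpred⟩ := path x hx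
  refine ⟨S, hS, ⟨z, hz⟩, fun y hy => ?_⟩
  obtain rfl | h := hpred y hy
  exacts [⟨z, hz, hzx⟩, h]

namespace ZFCAxioms

variable (hM : ZFCAxioms M)
include hM

theorem not_transGen_mem_self (x : M) : ¬ Relation.TransGen Mem x x := by
  intro hx
  -- The cycle is only given outside `M`, but finite sets of elements of `M` are internal.
  obtain ⟨S, hS, ⟨y, hy⟩, hpred⟩ := exists_finite_of_transGen_self hx
  obtain ⟨a, ha⟩ := hM.internal_of_finite hS
  obtain ⟨x, hxa, hmin⟩ := hM.foundation a ⟨y, (ha y).2 hy⟩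
  obtain ⟨z, hz, hzx⟩ := hpred x ((ha x).1 hxa)
  exact hmin z hzx ((ha z).2 hz)

theorem ne_of_transGen_mem {x y : M} (h : Relation.TransGen Mem x y) : x ≠ y := by
  rintro rfl
  exact hM.not_transGen_mem_self x h

theorem ne_of_mem {x y : M} (h : Mem x y) : x ≠ y :=
  hM.ne_of_transGen_mem (.single h)

theorem mem_asymm (x y : M) (hxy : Mem x y) : ¬ Mem y x :=
  fun hyx => hM.not_transGen_mem_self x (.tail (.single hxy) hyx)

theorem infinite : Infinite M := by
  refine not_finite_iff_infinite.1 fun _ => ?_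
  obtain ⟨b, hb⟩ := hM.internal_of_finite (finite_univ (α := M))
  exact hM.ne_of_mem ((hb b).2 trivial) rfl

end ZFCAxioms

/-- `M ⊨ x` is a transitive set. -/
def IsTransitive (x : M) : Prop := ∀ y, Mem y x → ∀ z, Mem z y → Mem z x

theorem SetAxioms.exists_isInductive_forall_isTransitive (hM : SetAxioms M) :
    ∃ a : M, IsInductive a ∧ ∀ x, Mem x a → IsTransitive x := by
  have definable_isTransitive : univ.Definable₁ setLang {x : M | IsTransitive x} :=
    definable_forall <| (definable_mem (.proj _) (.proj _)).himp <|
      definable_forall <| (definable_mem (.proj _) (.proj _)).himp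
        (definable_mem (.proj _) (.proj _))
  obtain ⟨a, ⟨e, he, hemp⟩, hsucc⟩ := hM.infinity
  obtain ⟨b, hb⟩ := hM.separation _ definable_isTransitive a
  refine ⟨b, ⟨⟨e, (hb e).2 ⟨he, fun y hy => (hemp y hy).elim⟩, hemp⟩, fun x hx => ?_⟩,
    fun x hx => ((hb x).1 hx).2⟩
  obtain ⟨hxa, hx⟩ := (hb x).1 hx
  obtain ⟨y, hy, hyx⟩ := hsucc x hxa
  refine ⟨y, (hb y).2 ⟨hy, fun u hu z hz => (hyx z).2 (.inl ?_)⟩, hyx⟩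
  obtain hu | rfl := (hyx u).1 hu
  exacts [hx u hu z hz, hz]

end Sets

section Codes

open Set Relation

variable {M : Type u} [setLang.Structure M] {α : Type*}

namespace InternalGraph

/-- `M ⊨ (x, y) ∈ edges`, for arbitrary elements `x` and `y` of `M`. -/
def Adj (G : InternalGraph M) (x y : M) : Prop := ∃ p, Mem p G.edges ∧ IsOrderedPair p x y

variable (hM : ZFCAxioms M) (G : InternalGraph M)

include hM in
theorem definable_adj {s t : (α → M) → M} (hs : univ.DefinableFun setLang s)
    (ht : univ.DefinableFun setLang t) : univ.Definable setLang {v | G.Adj (s v) (t v)} := by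
  simp only [Adj, hM.isOrderedPair_iff, exists_eq_right]
  have hpair := hM.isClassFunction₂_pair
  exact definable_mem (hpair.comp (hpair.comp hs hs) (hpair.comp hs ht))
    (definableFun_const setLang α (mem_univ _))

/-- The set `{V}`, where `V` is the vertex set of `G`: by Foundation it is not in the
transitive closure of any vertex, so it can mark the codes of vertices. -/
noncomputable def anchor : M := hM.pair G.dom G.dom

/-- The set `{{V}, v}`, which becomes the vertex of the D-graph corresponding to `v`. -/
noncomputable def code (v : M) : M := hM.pair (G.anchor hM) v

/-- The set `{{{V}}, v}`, which makes the neighborhood codes of distinct vertices distinct. -/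
noncomputable def tag (v : M) : M := hM.pair (hM.pair (G.anchor hM) (G.anchor hM)) v

theorem isClassFunction_code : IsClassFunction (G.code hM) :=
  hM.isClassFunction₂_pair.comp (definableFun_const setLang _ (mem_univ _)) (.proj _)

theorem internal_code_image_union_tag (v : M) :
    Internal (G.code hM '' {w | Mem w G.dom ∧ G.Adj w v} ∪ {G.tag hM v}) := by
  have definable_nbhd : univ.Definable₁ setLang {w | G.Adj w v} :=
    G.definable_adj hM (.proj _) (definableFun_const setLang _ (mem_univ _))
  exact hM.internal_union (hM.internal_image (G.isClassFunction_code hM)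
    (hM.separation _ definable_nbhd G.dom)) (hM.internal_singleton _)

/-- The set that is exchanged with `code v`: it consists of the codes of the neighbors of `v`
and of `tag v`. -/
noncomputable def nbhdCode (v : M) : M := (G.internal_code_image_union_tag hM v).choose

variable {G} {v w x y z : M}

theorem mem_anchor_iff : Mem z (G.anchor hM) ↔ z = G.dom :=
  hM.mem_pair_iff.trans or_self_iff

theorem mem_code_iff : Mem z (G.code hM v) ↔ z = G.anchor hM ∨ z = v :=
  hM.mem_pair_iff

theorem mem_tag_iff :
    Mem z (G.tag hM v) ↔ z = hM.pair (G.anchor hM) (G.anchor hM) ∨ z = v :=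
  hM.mem_pair_iff

theorem mem_nbhdCode_iff : Mem z (G.nbhdCode hM v) ↔
    (∃ w, (Mem w G.dom ∧ G.Adj w v) ∧ G.code hM w = z) ∨ z = G.tag hM v :=
  (G.internal_code_image_union_tag hM v).choose_spec z

theorem isClassFunction_nbhdCode : IsClassFunction (G.nbhdCode hM) := by
  have hpair := hM.isClassFunction₂_pair
  refine hM.definableFun_of_mem_iff (fun v z => mem_nbhdCode_iff hM) (.union ?_ ?_)
  · refine definable_exists (.inter (.inter ?_ ?_) ?_)
    · exact definable_mem (.proj _) (definableFun_const setLang _ (mem_univ _))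
    · exact G.definable_adj hM (.proj _) (.proj _)
    · exact ((G.isClassFunction_code hM).comp (.proj _)).ofPred_eq (.proj _)
  · exact (DefinableFun.proj _).ofPred_eq
      (hpair.comp (definableFun_const setLang _ (mem_univ _)) (.proj _))

theorem pair_anchor_mem_tag :
    Mem (hM.pair (G.anchor hM) (G.anchor hM)) (G.tag hM v) :=
  hM.mem_pair_left _ _

theorem tag_mem_nbhdCode : Mem (G.tag hM v) (G.nbhdCode hM v) :=
  (mem_nbhdCode_iff hM).2 (.inr rfl)

theorem anchor_mem_code : Mem (G.anchor hM) (G.code hM v) :=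
  hM.mem_pair_left _ _

theorem dom_mem_anchor : Mem G.dom (G.anchor hM) :=
  (mem_anchor_iff hM).2 rfl

theorem transGen_mem_anchor (hv : Mem v G.dom) : TransGen Mem v (G.anchor hM) :=
  .tail (.single hv) (dom_mem_anchor hM)

theorem anchor_ne (hv : Mem v G.dom) : G.anchor hM ≠ v :=
  (hM.ne_of_transGen_mem (transGen_mem_anchor hM hv)).symm

theorem transGen_anchor_tag : TransGen Mem (G.anchor hM) (G.tag hM v) :=
  .tail (.single (hM.mem_pair_left _ _)) (pair_anchor_mem_tag hM)

theorem transGen_anchor_nbhdCode : TransGen Mem (G.anchor hM) (G.nbhdCode hM v) :=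
  (transGen_anchor_tag hM).tail (tag_mem_nbhdCode hM)

theorem not_mem_code_of_transGen (hv : Mem v G.dom) (hz : TransGen Mem (G.anchor hM) z) :
    ¬ Mem z (G.code hM v) := by
  intro h
  obtain rfl | rfl := (mem_code_iff hM).1 h
  · exact hM.not_transGen_mem_self _ hz
  · exact hM.not_transGen_mem_self _ (hz.trans (transGen_mem_anchor hM hv))

theorem code_injective : Function.Injective (G.code hM) :=
  hM.pair_right_injective _

theorem code_ne_tag (hw : Mem w G.dom) : G.code hM v ≠ G.tag hM w := by
  intro h
  have hmem : Mem (G.anchor hM) (G.tag hM w) := h ▸ anchor_mem_code hM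
  obtain h | h := (mem_tag_iff hM).1 hmem
  · exact hM.ne_of_mem (hM.mem_pair_left _ _) h
  · exact anchor_ne hM hw h

theorem nbhdCode_injOn : InjOn (G.nbhdCode hM) {v | Mem v G.dom} := by
  intro v hv w _ h
  have hmem : Mem (G.tag hM v) (G.nbhdCode hM w) := h ▸ tag_mem_nbhdCode hM
  obtain ⟨u, -, hu⟩ | h := (mem_nbhdCode_iff hM).1 hmem
  · exact (code_ne_tag hM hv hu).elim
  · exact hM.pair_right_injective _ h

theorem code_ne_nbhdCode (hv : Mem v G.dom) : G.code hM v ≠ G.nbhdCode hM w := by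
  intro h
  exact not_mem_code_of_transGen hM hv (transGen_anchor_tag hM) (h ▸ tag_mem_nbhdCode hM)

theorem code_mem_nbhdCode_iff (hv : Mem v G.dom) (hw : Mem w G.dom) :
    Mem (G.code hM v) (G.nbhdCode hM w) ↔ G.Adj v w := by
  refine (mem_nbhdCode_iff hM).trans ⟨?_, fun h => .inl ⟨v, ⟨hv, h⟩, rfl⟩⟩
  rintro (⟨u, ⟨-, h⟩, hu⟩ | h)
  · rwa [← code_injective hM hu]
  · exact (code_ne_tag hM hw h).elim

theorem not_code_mem_code (hw : Mem w G.dom) : ¬ Mem (G.code hM v) (G.code hM w) :=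
  not_mem_code_of_transGen hM hw (.single (anchor_mem_code hM))

theorem not_nbhdCode_mem_code (hw : Mem w G.dom) : ¬ Mem (G.nbhdCode hM v) (G.code hM w) :=
  not_mem_code_of_transGen hM hw (transGen_anchor_nbhdCode hM)

theorem not_mem_code_of_nbhdCode_mem (hv : Mem v G.dom) (hy : Mem (G.nbhdCode hM v) y) :
    ¬ Mem y (G.code hM v) :=
  not_mem_code_of_transGen hM hv ((transGen_anchor_nbhdCode hM).tail hy)

theorem not_mem_nbhdCode_of_code_mem (hv : Mem v G.dom) (hy : Mem (G.code hM v) y) :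
    ¬ Mem y (G.nbhdCode hM v) := by
  intro h
  obtain ⟨w, ⟨hw, -⟩, rfl⟩ | rfl := (mem_nbhdCode_iff hM).1 h
  · exact not_code_mem_code hM hw hy
  obtain h | h := (mem_tag_iff hM).1 hy
  · exact anchor_ne hM hv (hM.eq_and_eq_of_pair_eq_pair_self h).2.symm
  · exact hM.ne_of_mem (hM.mem_pair_right _ _) h.symm

theorem not_isTransitive_code (hv : Mem v G.dom) : ¬ IsTransitive (G.code hM v) := by
  intro h
  have hdom := h _ (anchor_mem_code hM) _ (dom_mem_anchor hM)
  obtain h | h := (mem_code_iff hM).1 hdom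
  · exact hM.ne_of_mem (dom_mem_anchor hM) h
  · exact hM.ne_of_mem hv h.symm

theorem not_isTransitive_nbhdCode : ¬ IsTransitive (G.nbhdCode hM v) := by
  intro h
  have hmem := h _ (tag_mem_nbhdCode hM) _ (pair_anchor_mem_tag hM)
  obtain ⟨w, ⟨hw, -⟩, h⟩ | h := (mem_nbhdCode_iff hM).1 hmem
  · exact anchor_ne hM hw (hM.eq_and_eq_of_pair_eq_pair_self h).2.symm
  · exact hM.ne_of_mem (pair_anchor_mem_tag hM) h

end InternalGraph

end Codes

section CodePerm

open Set

variable {M : Type u} [setLang.Structure M]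

namespace InternalGraph

variable (hM : ZFCAxioms M) (G : InternalGraph M)

/-- The permutation of `M` that exchanges `code v` and `nbhdCode v` for every vertex `v`. -/
noncomputable def codePerm : Equiv.Perm M :=
  exchangePerm (f := fun v : {v // Mem v G.dom} => G.code hM v) (g := fun v => G.nbhdCode hM v)
    ((code_injective hM).comp Subtype.val_injective) (nbhdCode_injOn hM).injective
    fun v _ => code_ne_nbhdCode hM v.2

variable {G} {x y : M}

theorem codePerm_eq_iff : G.codePerm hM x = y ↔
    (∃ v, Mem v G.dom ∧ G.code hM v = x ∧ G.nbhdCode hM v = y) ∨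
      (∃ v, Mem v G.dom ∧ G.nbhdCode hM v = x ∧ G.code hM v = y) ∨
      ((¬ ∃ v, Mem v G.dom ∧ G.code hM v = x) ∧ ¬ ∃ v, Mem v G.dom ∧ G.nbhdCode hM v = x) ∧
        x = y := by
  refine (exchange_eq_iff ?_ ?_ ?_).trans ?_
  · exact (code_injective hM).comp Subtype.val_injective
  · exact (nbhdCode_injOn hM).injective
  · exact fun v _ => code_ne_nbhdCode hM v.2
  · simp only [Subtype.exists, Subtype.forall, exists_prop, not_exists, not_and, ne_eq]

theorem isClassFunction_codePerm : IsClassFunction (G.codePerm hM) := by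
  have dom {α : Type} (o : α) : univ.Definable setLang {w : α → M | Mem (w o) G.dom} :=
    definable_mem (.proj _) (definableFun_const setLang _ (mem_univ _))
  have code {α : Type} (o p : α) : univ.Definable setLang {w : α → M | G.code hM (w o) = w p} :=
    ((isClassFunction_code hM G).comp (.proj _)).ofPred_eq (.proj _)
  have nbhdCode {α : Type} (o p : α) :
      univ.Definable setLang {w : α → M | G.nbhdCode hM (w o) = w p} :=
    ((isClassFunction_nbhdCode hM).comp (.proj _)).ofPred_eq (.proj _)
  have graph_eq : (fun v : Unit → M => G.codePerm hM (v ())).tupleGraph =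
      {w | G.codePerm hM (w (some ())) = w none} := rfl
  rw [IsClassFunction, DefinableFun, graph_eq]
  simp only [codePerm_eq_iff]
  refine .union ?_ (.union ?_ (.inter (.inter ?_ ?_) ?_))
  · exact definable_exists ((dom _).inter ((code _ _).inter (nbhdCode _ _)))
  · exact definable_exists ((dom _).inter ((nbhdCode _ _).inter (code _ _)))
  · exact (definable_exists ((dom _).inter (code _ _))).compl
  · exact (definable_exists ((dom _).inter (nbhdCode _ _))).compl
  · exact (DefinableFun.proj _).ofPred_eq (DefinableFun.proj _)

theorem codePerm_of_isTransitive (hx : IsTransitive x) : G.codePerm hM x = x := by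
  refine exchange_apply_of_ne ?_ ?_
  · rintro v rfl
    exact not_isTransitive_code hM v.2 hx
  · rintro v rfl
    exact not_isTransitive_nbhdCode hM hx

theorem setAxioms_permModel : SetAxioms (PermModel (G.codePerm hM)) := by
  obtain ⟨a, ha, htrans⟩ := hM.exists_isInductive_forall_isTransitive
  exact PermModel.setAxioms hM.toSetAxioms (isClassFunction_codePerm hM)
    ⟨a, ha, fun x hx => codePerm_of_isTransitive hM (htrans x hx)⟩

theorem dGraph_permModel_adj_iff : (dGraph (PermModel (G.codePerm hM))).Adj x y ↔
    Relation.Map G.toGraph.Adj (fun v => G.code hM v) (fun v => G.code hM v) x y := by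
  refine (rel_exchange_and_iff hM.mem_asymm ?_ ?_ ?_ ?_ ?_ ?_ ?_).trans ?_
  · exact (code_injective hM).comp Subtype.val_injective
  · exact (nbhdCode_injOn hM).injective
  · exact fun v _ => code_ne_nbhdCode hM v.2
  · exact fun _ w => not_code_mem_code hM w.2
  · exact fun _ w => not_nbhdCode_mem_code hM w.2
  · exact fun v _ => not_mem_code_of_nbhdCode_mem hM v.2
  · exact fun v _ => not_mem_nbhdCode_of_code_mem hM v.2
  · have adj_iff (v w : {v // Mem v G.dom}) :
        Mem (G.code hM v) (G.nbhdCode hM w) ∧ Mem (G.code hM w) (G.nbhdCode hM v) ↔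
          G.toGraph.Adj v w := by
      rw [code_mem_nbhdCode_iff hM v.2 w.2, code_mem_nbhdCode_iff hM w.2 v.2]
      exact and_iff_left_of_imp (G.toGraph.symm v w)
    simp only [adj_iff]
    rfl

theorem infinite_compl_range_code :
    (range fun v : {v // Mem v G.dom} => G.code hM v)ᶜ.Infinite := by
  have := hM.infinite
  refine infinite_of_injective_forall_mem (f := fun x => hM.pair x x) ?_ ?_
  · exact fun x y h => (hM.eq_and_eq_of_pair_eq_pair_self h).1
  · rintro x ⟨v, hv⟩
    obtain ⟨hx, hv'⟩ := hM.eq_and_eq_of_pair_eq_pair_self hv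
    exact anchor_ne hM v.2 (hx.trans hv'.symm)

end InternalGraph

end CodePerm

end DoubleMembership

theorem mainTheorem9 (M : Type u) [DoubleMembership.setLang.Structure M]
    (hM : M ⊨ DoubleMembership.ZFC) (G : DoubleMembership.InternalGraph M) :
    ∃ (N : Type u) (_ : DoubleMembership.setLang.Structure N),
      N ⊨ DoubleMembership.ZFCWithoutFoundation ∧
      ∃ I : Type u, Infinite I ∧
        (DoubleMembership.dGraph N).Iso (G.toGraph.addIsolated I) := by
  open DoubleMembership InternalGraph in
  have hZFC := models_ZFC_iff.1 hM
  refine ⟨PermModel (G.codePerm hZFC), inferInstance,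
    models_ZFCWithoutFoundation_iff.2 (setAxioms_permModel hZFC), _,
    (infinite_compl_range_code hZFC (G := G)).to_subtype, LoopGraph.iso_addIsolated ?_ ?_⟩
  · exact (code_injective hZFC).comp Subtype.val_injective
  · exact fun x y => dGraph_permModel_adj_iff hZFC
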